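/- Let $\Phi$ be an infinite set of propositions, and let $\mathcal{ONL}_n$ be the set of formulas built from $\Phi$ by $\neg$, $\vee$ and the modal operators $\mathbf L_i$, $\mathbf N_i$ for the two agents $i\in\{a,b\}$; $\supset$ and $\wedge$ are the usual abbreviations, and $\Box_i$ stands for $\mathbf L_i$ or $\mathbf N_i$. *Syntactic notions.* A formula is *basic* if no $\mathbf N_i$ occurs in it. It is *$i$-objective* if every modal operator in it that is not in the scope of another one is a $\Box_j$ with $j\ne i$. It is *$i$-subjective* if every proposition occurs in the scope of a modal operator and every modal operator that is not in the scope of another one is a $\Box_i$. The $i$-depth is given by $|p|_i=1$, $|\neg\alpha|_i=|\alpha|_i$, $|\alpha\vee\beta|_i=\max(|\alpha|_i,|\beta|_i)$, $|\Box_i\alpha|_i=|\alpha|_i$, and $|\Box_j\alpha|_i=|\alpha|_j+1$ for $j\neq i$. $\mathcal{ONL}_n^1$ is the set of formulas in which no $\mathbf N_j$ occurs in the scope of an $\mathbf L_i$ or $\mathbf N_i$ with $i\neq j$; $\mathcal{ONL}_n^{t+1}$ is the set of Boolean combinations of formulas of $\mathcal{ONL}_n^t$ and formulas $\mathbf L_i\alpha$,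 $\mathbf N_i\alpha$ with $\alpha\in\mathcal{ONL}_n^t$. *Semantics.* A world is a subset of $\Phi$, and $\mathcal W$ is the set of worlds. Let $\mathbb E^0=\{\{\}\}$, and let $\mathbb E^k$ ($k\ge1$), the set of $k$-structures, be the set of all subsets of $\mathcal W\times\mathbb E^{k-1}$. A $(k,j)$-model is a triple $(e_a^k,e_b^j,w)$ with $e_a^k\in\mathbb E^k$, $e_b^j\in\mathbb E^j$, $w\in\mathcal W$. Truth of $p\in\Phi$ means $p\in w$; $\neg$ and $\vee$ are treated classically; $e_a^k,e_b^j,w\models\mathbf L_a\alpha$ iff $e_a^k,e_b^{k-1},w'\models\alpha$ for all $\langle w',e_b^{k-1}\rangle\in e_a^k$; $e_a^k,e_b^j,w\models\mathbf N_a\alpha$ iff $e_a^k,e_b^{k-1},w'\models\alpha$ for all $\langle w',e_b^{k-1}\rangle\in(\mathcal W\times\mathbb E^{k-1})\setminus e_a^k$; and symmetrically for $b$. A formula $\alpha$ with $|\alpha|_a=k$ and $|\alpha|_b=j$ is *valid*, $\models\alpha$, if it is true at all $(k,j)$-models. *Proof systems.* For $t\geq 1$, $AX_n^t$ is the system for $\mathcal{ONL}_n$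 with modus ponens, necessitation for all $\mathbf L_i$ and $\mathbf N_i$, and the axioms - $\mathbf{A1}_n$: all instances of propositional tautologies; - $\mathbf{A2}_n$: $\mathbf L_i(\alpha\supset\beta)\supset(\mathbf L_i\alpha\supset\mathbf L_i\beta)$; - $\mathbf{A3}_n$: $\mathbf N_i(\alpha\supset\beta)\supset(\mathbf N_i\alpha\supset\mathbf N_i\beta)$; - $\mathbf{A4}_n$: $\sigma\supset\mathbf L_i\sigma\wedge\mathbf N_i\sigma$ for $i$-subjective $\sigma$; - $\mathbf{A5}_n^1$: $\mathbf N_i\alpha\supset\neg\mathbf L_i\alpha$, if $\neg\alpha$ is a basic $i$-objective formula that is consistent in the modal logic $\mathsf{K45}_n$ (with operators $\mathbf L_a,\mathbf L_b$, over basic formulas); - $\mathbf{A5}_n^{s+1}$, for each $1\le s<t$: $\mathbf N_i\alpha\supset\neg\mathbf L_i\alpha$, if $\neg\alpha\in\mathcal{ONL}_n^s$ is $i$-objective and $AX_n^s$-consistent. A formula is consistent in a system if its negation is not provable there. **Theorem.** For every $t\ge1$ and every $\alpha\in\mathcal{ONL}_n^t$, if $AX_n^t\vdash\alpha$ then $\models\alpha$.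 -/

import Mathlib

universe u

namespace OnlyKnowing

/-- The two agents, Alice and Bob. -/
inductive Agent where
  | a : Agent
  | b : Agent
  deriving DecidableEq

/-- Formulas of the propositional language with the modalities `L i` (at least known) and
`N i` (at most the negation is known); disjunction and negation are the primitive connectives. -/
inductive Form (Φ : Type u) where
  | atom : Φ → Form Φ
  | neg : Form Φ → Form Φ
  | or : Form Φ → Form Φ → Form Φ
  | L : Agent → Form Φ → Form Φ
  | N : Agent → Form Φ → Form Φ

namespace Form

variable {Φ : Type u}

def imp (α β : Form Φ) : Form Φ := or (neg α) β

def and (α β : Form Φ) : Form Φ := neg (or (neg α) (neg β))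

/-- `depth α i` is the `i`-depth of `α`. -/
def depth : Form Φ → Agent → ℕ
  | atom _, _ => 1
  | neg α, i => depth α i
  | or α β, i => max (depth α i) (depth β i)
  | L j α, i => if j = i then depth α i else depth α j + 1
  | N j α, i => if j = i then depth α i else depth α j + 1

/-- Every modality that is not in the scope of another one belongs to an agent other than `i`. -/
def Objective (i : Agent) : Form Φ → Prop
  | atom _ => True
  | neg α => Objective i α
  | or α β => Objective i α ∧ Objective i β
  | L j _ => j ≠ i
  | N j _ => j ≠ i

/-- Every atom is in the scope of a modality, and every modality that is not in the scope of
another one belongs to `i`. -/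
def Subjective (i : Agent) : Form Φ → Prop
  | atom _ => False
  | neg α => Subjective i α
  | or α β => Subjective i α ∧ Subjective i β
  | L j _ => j = i
  | N j _ => j = i

/-- The modality `N i` occurs somewhere in the formula. -/
def MentionsN (i : Agent) : Form Φ → Prop
  | atom _ => False
  | neg α => MentionsN i α
  | or α β => MentionsN i α ∨ MentionsN i β
  | L _ α => MentionsN i α
  | N j α => j = i ∨ MentionsN i α

/-- No `N i` occurs. -/
def Basic (α : Form Φ) : Prop := ∀ i, ¬ MentionsN i α

/-- No `N j` occurs in the scope of `L i` or `N i` with `i ≠ j`. -/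
def InMinus : Form Φ → Prop
  | atom _ => True
  | neg α => InMinus α
  | or α β => InMinus α ∧ InMinus β
  | L i α => InMinus α ∧ ∀ j, j ≠ i → ¬ MentionsN j α
  | N i α => InMinus α ∧ ∀ j, j ≠ i → ¬ MentionsN j α

end Form

variable {Φ : Type u}

/-- Boolean combinations of the formulas in `S`. -/
inductive BoolComb (S : Set (Form Φ)) : Form Φ → Prop
  | base {α : Form Φ} : α ∈ S → BoolComb S α
  | neg {α : Form Φ} : BoolComb S α → BoolComb S (.neg α)
  | or {α β : Form Φ} : BoolComb S α → BoolComb S β → BoolComb S (.or α β)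

/-- The hierarchy of languages, indexed by `t ≥ 1` (the entry at `0` is not used). -/
def ONL (Φ : Type u) : ℕ → Set (Form Φ)
  | 0 => ∅
  | 1 => {α | α.InMinus}
  | t + 2 => {α | BoolComb
      (ONL Φ (t + 1) ∪ {γ | ∃ i, ∃ β ∈ ONL Φ (t + 1), γ = .L i β ∨ γ = .N i β}) α}

/-! ### Semantics -/

/-- A world is a valuation, given as the set of the propositions true at it. -/
abbrev World (Φ : Type u) := Set Φ

/-- `EStruct Φ k` is the type of `k`-structures. The only `0`-structure is the placeholder `{}`,
so that a `1`-structure is a set of pairs of a world and that placeholder. -/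
def EStruct (Φ : Type u) : ℕ → Type u
  | 0 => PUnit.{u + 1}
  | k + 1 => Set (World Φ × EStruct Φ k)

/-- The set of pairs that a structure of positive level is. -/
def EStruct.pairs {k : ℕ} (e : EStruct Φ (k + 1)) : Set (World Φ × EStruct Φ k) := e

/-- Truth of a formula at `(ea, eb, w)`. A modality of an agent whose structure has level `0` is
given the dummy value `True`; such a modality is never reached when a formula is evaluated in a
`(k, j)`-model with `k` at least its `a`-depth and `j` at least its `b`-depth. -/
def Sat : Form Φ → {k j : ℕ} → EStruct Φ k → EStruct Φ j → World Φ → Prop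
  | .atom p, _, _, _, _, w => p ∈ w
  | .neg α, _, _, ea, eb, w => ¬ Sat α ea eb w
  | .or α β, _, _, ea, eb, w => Sat α ea eb w ∨ Sat β ea eb w
  | .L .a α, k + 1, _, ea, _, _ =>
      ∀ (w' : World Φ) (eb' : EStruct Φ k), (w', eb') ∈ ea.pairs → Sat α ea eb' w'
  | .N .a α, k + 1, _, ea, _, _ =>
      ∀ (w' : World Φ) (eb' : EStruct Φ k), (w', eb') ∉ ea.pairs → Sat α ea eb' w'
  | .L .b α, _, j + 1, _, eb, _ =>
      ∀ (w' : World Φ) (ea' : EStruct Φ j), (w', ea') ∈ eb.pairs → Sat α ea' eb w'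
  | .N .b α, _, j + 1, _, eb, _ =>
      ∀ (w' : World Φ) (ea' : EStruct Φ j), (w', ea') ∉ eb.pairs → Sat α ea' eb w'
  | .L .a _, 0, _, _, _, _ => True
  | .N .a _, 0, _, _, _, _ => True
  | .L .b _, _, 0, _, _, _ => True
  | .N .b _, _, 0, _, _, _ => True

/-- Truth at all `(k, j)`-models, `k` and `j` being the `a`-depth and the `b`-depth of `α`. -/
def Valid (α : Form Φ) : Prop :=
  ∀ (ea : EStruct Φ (α.depth .a)) (eb : EStruct Φ (α.depth .b)) (w : World Φ), Sat α ea eb w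

/-! ### Proof theory -/

/-- Instances of propositional tautologies: true under every assignment of truth values to
formulas that respects negation and disjunction. -/
def Tautology (α : Form Φ) : Prop :=
  ∀ v : Form Φ → Prop, (∀ β, v (.neg β) ↔ ¬ v β) → (∀ β γ, v (.or β γ) ↔ (v β ∨ v γ)) → v α

/-- Provability in the modal logic K45 with the modalities `L i`, over basic formulas. -/
inductive K45 : Form Φ → Prop
  | taut {α : Form Φ} : α.Basic → Tautology α → K45 α
  | distr (i : Agent) {α β : Form Φ} : α.Basic → β.Basic →
      K45 (.imp (.L i (.imp α β)) (.imp (.L i α) (.L i β)))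
  | four (i : Agent) {α : Form Φ} : α.Basic → K45 (.imp (.L i α) (.L i (.L i α)))
  | five (i : Agent) {α : Form Φ} : α.Basic →
      K45 (.imp (.neg (.L i α)) (.L i (.neg (.L i α))))
  | mp {α β : Form Φ} : K45 (.imp α β) → K45 α → K45 β
  | nec (i : Agent) {α : Form Φ} : K45 α → K45 (.L i α)

/-- Provability from the axiom schemes A1 to A4 and the additional axioms in `A`, by modus ponens
and necessitation for all modalities. -/
inductive Derives (A : Set (Form Φ)) : Form Φ → Prop
  | ax1 {α : Form Φ} : Tautology α → Derives A α
  | ax2 (i : Agent) (α β : Form Φ) :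
      Derives A (.imp (.L i (.imp α β)) (.imp (.L i α) (.L i β)))
  | ax3 (i : Agent) (α β : Form Φ) :
      Derives A (.imp (.N i (.imp α β)) (.imp (.N i α) (.N i β)))
  | ax4 (i : Agent) {σ : Form Φ} : σ.Subjective i →
      Derives A (.imp σ (.and (.L i σ) (.N i σ)))
  | ax5 {α : Form Φ} : α ∈ A → Derives A α
  | mp {α β : Form Φ} : Derives A (.imp α β) → Derives A α → Derives A β
  | necL (i : Agent) {α : Form Φ} : Derives A α → Derives A (.L i α)
  | necN (i : Agent) {α : Form Φ} : Derives A α → Derives A (.N i α)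

/-- `α` is consistent with respect to a notion of provability: its negation is not provable. -/
def Consistent (prov : Form Φ → Prop) (α : Form Φ) : Prop := ¬ prov (.neg α)

/-- `A5 Φ t` consists of all instances of the schemes A5 of index `1, …, t`
(there are none for `t = 0`). -/
def A5 (Φ : Type u) : ℕ → Set (Form Φ)
  | 0 => ∅
  | 1 => {γ | ∃ (i : Agent) (α : Form Φ), γ = .imp (.N i α) (.neg (.L i α)) ∧
      (Form.neg α).Basic ∧ (Form.neg α).Objective i ∧ Consistent K45 (Form.neg α)}
  | t + 2 => A5 Φ (t + 1) ∪
      {γ | ∃ (i : Agent) (α : Form Φ), γ = .imp (.N i α) (.neg (.L i α)) ∧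
        Form.neg α ∈ ONL Φ (t + 1) ∧ (Form.neg α).Objective i ∧
        Consistent (Derives (A5 Φ (t + 1))) (Form.neg α)}

/-- Provability in the axiom system of index `t ≥ 1`. -/
def AX (t : ℕ) (α : Form Φ) : Prop := Derives (A5 Φ t) α

end OnlyKnowing

/-!
The difficulty of soundness lies in the axioms A5: `N i α ⊃ ¬ L i α` is true once `¬ α` is true at
some pair of a world and a structure of the other agent, because that pair belongs to the structure
of `i` or to its complement (`eventuallyValid_of_mem_A5`). So a consistent formula has to be
satisfiable, and soundness for the index `t` rests on completeness for all smaller indices. Both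
are proved together by strong induction on the index (`eventuallyValid_of_derives`,
`exists_holds_of_consistent`), with K45 as the system of index `0` (`mem_A5_iff`); replacing all `N`
by `L` shows that the axioms A1 to A4 are conservative over K45 (`k45_iff_derives`).

The points `(e_a, e_b, w)` of all levels together form a Kripke model in which the modalities of an
agent preserve the truth of formulas subjective for it, and so do the maximal consistent sets. For
two nodes of such models, agreement on finitely many formulas, the `probes`, is a bisimulation of
bounded depth, which gives agreement on all formulas built from the given atoms with few enough
modalities and few enough layers of `N` (`Model.holds_iff_of_agreeOn`).

What remains is to realize a node by a structure `e` (`exists_realizes_succ`). The members of `e`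
have to look like the `L`-successors of the node, the members of the complement like the
`N`-successors, and each successor has to be met. A successor of both kinds is placed on both
sides, in two copies that differ in an atom not among the finitely many relevant ones; here the
infinity of the set of atoms is used. It is also necessary that every possible pair looks like some
successor. For maximal consistent sets this is the effect of A5: a state description true at a pair
is consistent by soundness for a smaller index, so its negation cannot be in the scope of both
`L i` and `N i` (`exists_realizes_of_isMaxConsistent`).

The same construction applied to structures of different levels shows that satisfiability does not
depend on the level (`exists_holds_of_le_level`). Derivations may pass through formulas of any
depth and any language, so soundness is stated for all sufficiently large levels, and only the
conclusion is brought down to the levels given by its depth (`EventuallyValid.valid`).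
-/

namespace OnlyKnowing

open Form

variable {Φ : Type u}

/-! ### Formulas and the language hierarchy -/

/-- The agent different from the given one. -/
def Agent.other : Agent → Agent
  | .a => .b
  | .b => .a

@[simp] theorem Agent.other_ne (i : Agent) : i.other ≠ i := by cases i <;> simp [Agent.other]

@[simp] theorem Agent.ne_other (i : Agent) : i ≠ i.other := by cases i <;> simp [Agent.other]

theorem Agent.eq_or_eq_other (i j : Agent) : j = i ∨ j = i.other := by
  cases i <;> cases j <;> simp [Agent.other]

theorem Agent.eq_other_of_ne {i j : Agent} (h : j ≠ i) : j = i.other :=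
  (i.eq_or_eq_other j).resolve_left h

namespace Form

/-- The two modalities of an agent under one name: `box false i` is `L i` and `box true i`
is `N i`. -/
def box : Bool → Agent → Form Φ → Form Φ
  | false, i, α => L i α
  | true, i, α => N i α

/-- The formula `p ∨ ¬ p`. -/
def top (p : Φ) : Form Φ := or (atom p) (neg (atom p))

/-- Induction on formulas that treats the two modalities alike. -/
theorem box_induction {motive : Form Φ → Prop} (φ : Form Φ) (atom : ∀ p, motive (atom p))
    (neg : ∀ α, motive α → motive (neg α))
    (or : ∀ α β, motive α → motive β → motive (or α β))
    (box : ∀ c i α, motive α → motive (box c i α)) : motive φ := by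
  induction φ with
  | atom p => exact atom p
  | neg α ih => exact neg α ih
  | or α β ih ih' => exact or α β ih ih'
  | L i α ih => exact box false i α ih
  | N i α ih => exact box true i α ih

@[simp] theorem subjective_box {c : Bool} {i j : Agent} {α : Form Φ} :
    (box c i α).Subjective j ↔ i = j := by cases c <;> rfl

@[simp] theorem objective_box {c : Bool} {i j : Agent} {α : Form Φ} :
    (box c i α).Objective j ↔ i ≠ j := by cases c <;> rfl

/-- The atoms that occur in a formula. -/
def atoms : Form Φ → List Φ
  | atom p => [p]
  | neg α => atoms α
  | or α β => atoms α ++ atoms β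
  | L _ α => atoms α
  | N _ α => atoms α

/-- The level that the structure of `i` must have for the evaluation of a formula never to meet a
modality of an agent whose structure has level `0`. It can be smaller than the `i`-depth, because a
modality of the other agent does not look at the structure of `i` that was given. -/
def need : Form Φ → Agent → ℕ
  | atom _, _ => 0
  | neg α, i => need α i
  | or α β, i => max (need α i) (need β i)
  | L j α, i => if j = i then max (need α i) (need α i.other + 1) else 0
  | N j α, i => if j = i then max (need α i) (need α i.other + 1) else 0

/-- A bound on the nesting of `N`: the modality `N i` may occur only where the current bound `s i`
is positive, and in the scope of a modality of `i` the bound for the other agent becomes `s i - 1`.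
A bound `0` is passed on as `0`. -/
def Nest : Form Φ → (Agent → ℕ) → Prop
  | atom _, _ => True
  | neg α, s => Nest α s
  | or α β, s => Nest α s ∧ Nest β s
  | L i α, s => Nest α (Function.update s i.other (s i - 1))
  | N i α, s => s i ≠ 0 ∧ Nest α (Function.update s i.other (s i - 1))

@[simp] theorem atoms_box (c : Bool) (i : Agent) (α : Form Φ) : (box c i α).atoms = α.atoms := by
  cases c <;> rfl

@[simp] theorem need_box_self (c : Bool) (i : Agent) (α : Form Φ) :
    (box c i α).need i = max (α.need i) (α.need i.other + 1) := by
  cases c <;> simp [box, need]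

theorem nest_box {c : Bool} {i : Agent} {α : Form Φ} {s : Agent → ℕ} :
    (box c i α).Nest s ↔
      (c = true → s i ≠ 0) ∧ α.Nest (Function.update s i.other (s i - 1)) := by
  cases c <;> simp [box, Nest]

theorem need_add_one_le_depth (φ : Form Φ) :
    ∀ i : Agent, φ.need i ≤ φ.depth i ∧ φ.need i.other + 1 ≤ φ.depth i := by
  have h : ∀ (c : Bool) (j : Agent) (α : Form Φ),
      (∀ i : Agent, α.need i ≤ α.depth i ∧ α.need i.other + 1 ≤ α.depth i) →
      ∀ i : Agent, (box c j α).need i ≤ (box c j α).depth i ∧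
        (box c j α).need i.other + 1 ≤ (box c j α).depth i := by
    intro c j α ih i
    have h1 := ih .a
    have h2 := ih .b
    cases c <;> cases j <;> cases i <;> simp [box, need, depth, Agent.other] at * <;> omega
  induction φ using box_induction with
  | atom p => intro i; simp [need, depth]
  | neg α ih => exact ih
  | or α β ih ih' =>
    intro i
    have h1 := ih i
    have h2 := ih' i
    simp only [need, depth]
    omega
  | box c j α ih => exact h c j α ih

theorem Nest.mono {φ : Form Φ} : ∀ {s s' : Agent → ℕ}, (∀ i, s i ≤ s' i) → φ.Nest s →
    φ.Nest s' := by
  induction φ using box_induction with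
  | atom p => intros; trivial
  | neg α ih => exact ih
  | or α β ih ih' => exact fun h hn => ⟨ih h hn.1, ih' h hn.2⟩
  | box c i α ih =>
    intro s s' h hn
    rw [nest_box] at hn ⊢
    have hi := h i
    refine ⟨fun hc => by have := hn.1 hc; omega, ih (fun j => ?_) hn.2⟩
    rcases i.eq_or_eq_other j with rfl | rfl
    · simpa using hi
    · simp only [Function.update_self]; omega

/-- In a formula of the first language of the hierarchy, `N` is not found under a change of agent,
so a bound that is positive where it has to be at the outset suffices. -/
theorem nest_of_inMinus {φ : Form Φ} : ∀ {s : Agent → ℕ}, φ.InMinus →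
    (∀ i, φ.MentionsN i → s i ≠ 0) → φ.Nest s := by
  have key : ∀ (i : Agent) (α : Form Φ) (s : Agent → ℕ), (∀ j, j ≠ i → ¬ MentionsN j α) →
      (α.MentionsN i → s i ≠ 0) →
      ∀ j, α.MentionsN j → Function.update s i.other (s i - 1) j ≠ 0 := by
    intro i α s h hi j hj
    rcases i.eq_or_eq_other j with rfl | rfl
    · simpa using hi hj
    · exact absurd hj (h _ i.other_ne)
  induction φ with
  | atom p => intros; trivial
  | neg α ih => exact ih
  | or α β ih ih' =>
    exact fun h hs => ⟨ih h.1 fun i hi => hs i (Or.inl hi), ih' h.2 fun i hi => hs i (Or.inr hi)⟩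
  | L i α ih => exact fun h hs => ih h.1 (key i α _ h.2 (hs i))
  | N i α ih =>
    exact fun h hs => ⟨hs i (Or.inl rfl), ih h.1 (key i α _ h.2 fun hi => hs i (Or.inr hi))⟩

theorem nest_of_need_le {φ : Form Φ} : ∀ {s : Agent → ℕ}, (∀ i, φ.need i ≤ s i) → φ.Nest s := by
  induction φ using box_induction with
  | atom p => intros; trivial
  | neg α ih => exact ih
  | or α β ih ih' =>
    exact fun h => ⟨ih fun i => (le_max_left _ _).trans (h i),
      ih' fun i => (le_max_right _ _).trans (h i)⟩
  | box c i α ih =>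
    intro s h
    have hi := h i
    rw [need_box_self] at hi
    refine nest_box.2 ⟨fun _ => by omega, ih fun j => ?_⟩
    rcases i.eq_or_eq_other j with rfl | rfl
    · simp only [ne_eq, Agent.ne_other, not_false_eq_true, Function.update_of_ne]; omega
    · simp only [Function.update_self]; omega

theorem Basic.inMinus {φ : Form Φ} (h : φ.Basic) : φ.InMinus := by
  induction φ with
  | atom p => trivial
  | neg α ih => exact ih h
  | or α β ih ih' =>
    exact ⟨ih fun i hi => h i (Or.inl hi), ih' fun i hi => h i (Or.inr hi)⟩
  | L i α ih => exact ⟨ih h, fun j _ => h j⟩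
  | N i α ih => exact absurd (Or.inl rfl) (h i)

end Form

/-- The hierarchy of languages together with the basic formulas as its stage `0`. -/
def Lang (Φ : Type u) : ℕ → Set (Form Φ)
  | 0 => {α | α.Basic}
  | s + 1 => ONL Φ (s + 1)

theorem atom_mem_lang (p : Φ) : ∀ s, .atom p ∈ Lang Φ s
  | 0 => fun _ h => h
  | 1 => trivial
  | s + 2 => .base (Or.inl (atom_mem_lang p (s + 1)))

theorem neg_mem_lang {α : Form Φ} : ∀ {s}, α ∈ Lang Φ s → .neg α ∈ Lang Φ s
  | 0, h => h
  | 1, h => h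
  | _ + 2, h => .neg h

theorem or_mem_lang {α β : Form Φ} :
    ∀ {s}, α ∈ Lang Φ s → β ∈ Lang Φ s → .or α β ∈ Lang Φ s
  | 0, h, h' => fun i hi => hi.elim (h i) (h' i)
  | 1, h, h' => ⟨h, h'⟩
  | _ + 2, h, h' => .or h h'

/-- Each modality leads from one stage of the hierarchy to the next. The truncated subtraction
covers the stage `0` too, where only `L i` is available and does not leave the stage. -/
theorem box_mem_lang {c : Bool} {i : Agent} {α : Form Φ} :
    ∀ {s}, α ∈ Lang Φ (s - 1) → (c = true → s ≠ 0) → box c i α ∈ Lang Φ s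
  | 0, h, hc => by
    cases c
    · exact h
    · exact absurd rfl (hc rfl)
  | 1, h, _ => by
    have h' : α.Basic := h
    cases c <;> exact ⟨h'.inMinus, fun j _ => h' j⟩
  | s + 2, h, _ => .base (Or.inr ⟨i, α, h, by cases c <;> simp [box]⟩)

theorem nest_of_mem_lang {α : Form Φ} : ∀ {s}, α ∈ Lang Φ s → α.Nest fun _ => s
  | 0, h => nest_of_inMinus (Basic.inMinus h) fun i hi => absurd hi (h i)
  | 1, h => nest_of_inMinus h fun _ _ => one_ne_zero
  | s + 2, h => by
    induction (h : BoolComb _ α) with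
    | neg _ ih => exact ih
    | or _ _ ih ih' => exact ⟨ih, ih'⟩
    | base h =>
      rcases h with h | ⟨i, β, hβ, rfl | rfl⟩
      · exact (nest_of_mem_lang (s := s + 1) h).mono fun _ => Nat.le_succ _
      all_goals
        have := (nest_of_mem_lang (s := s + 1) hβ).mono
          (s' := Function.update (fun _ => s + 2) i.other (s + 1)) fun j => by
            by_cases hj : j = i.other <;> simp [Function.update, hj]
      · exact this
      · exact ⟨by simp, this⟩

/-! ### Introspective models and agreement of nodes -/

/-- A Kripke model with nodes in `X` for the modalities of both agents, given by its truth relation.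
The field `subj` is the introspection property: `Rel c i` preserves the truth of `i`-subjective
formulas. -/
structure Model (Φ : Type u) (X : Type*) where
  /-- Truth of a formula at a node. -/
  Holds : X → Form Φ → Prop
  /-- The accessibility relation of the modality `box c i`. -/
  Rel : Bool → Agent → X → X → Prop
  neg : ∀ x α, Holds x (.neg α) ↔ ¬ Holds x α
  or : ∀ x α β, Holds x (.or α β) ↔ (Holds x α ∨ Holds x β)
  box : ∀ c i x α, Holds x (.box c i α) ↔ ∀ y, Rel c i x y → Holds y α
  subj : ∀ {c i x y}, Rel c i x y → ∀ {σ : Form Φ}, σ.Subjective i → (Holds x σ ↔ Holds y σ)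

/-- The formulas of `G` have the same truth value according to `S` and to `T`. -/
def AgreeOn (G : List (Form Φ)) (S T : Form Φ → Prop) : Prop := ∀ g ∈ G, (S g ↔ T g)

theorem AgreeOn.symm {G : List (Form Φ)} {S T : Form Φ → Prop} (h : AgreeOn G S T) :
    AgreeOn G T S := fun g hg => (h g hg).symm

/-- The state descriptions of a list of formulas: all conjunctions that contain each formula of
the list or its negation. The atom `q` only serves to express the empty conjunction. -/
def stateDescs (q : Φ) : List (Form Φ) → List (Form Φ)
  | [] => [top q]
  | g :: G => (stateDescs q G).map (and g) ++ (stateDescs q G).map (and (neg g))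

/-- The formulas that describe a structure of the agent `i` up to nesting depth `m` of
modalities, with at most `s` layers of the modalities `N`: they say which state descriptions, built
from the atoms in `P` and the formulas of this kind for the other agent with both bounds lowered,
are possible for `L i` and for `N i`. The truncated subtraction makes `s = 0` mean that `N` does
not occur at all. -/
def probes (P : List Φ) (q : Φ) : ℕ → ℕ → Agent → List (Form Φ)
  | _, 0, _ => []
  | s, m + 1, i =>
    let D := stateDescs q (P.map atom ++ probes P q (s - 1) m i.other)
    D.map (fun d => L i (neg d)) ++ if s = 0 then [] else D.map (fun d => N i (neg d))

/-- The formulas whose state descriptions occur in `probes P q s (m + 1) i`. -/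
def cells (P : List Φ) (q : Φ) (s m : ℕ) (i : Agent) : List (Form Φ) :=
  P.map atom ++ probes P q (s - 1) m i.other

theorem mem_probes_succ {P : List Φ} {q : Φ} {s m : ℕ} {i : Agent} {φ : Form Φ} :
    φ ∈ probes P q s (m + 1) i ↔ ∃ c, (c = true → s ≠ 0) ∧
      ∃ d ∈ stateDescs q (cells P q s m i), φ = box c i (neg d) := by
  by_cases hs : s = 0 <;> simp [probes, cells, hs, box, eq_comm]

theorem agreeOn_cells {P : List Φ} {q : Φ} {s m : ℕ} {i : Agent} {S T : Form Φ → Prop} :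
    AgreeOn (cells P q s m i) S T ↔
      (∀ p ∈ P, S (atom p) ↔ T (atom p)) ∧ AgreeOn (probes P q (s - 1) m i.other) S T := by
  simp [AgreeOn, cells, or_imp, forall_and]

theorem subjective_of_mem_probes {P : List Φ} {q : Φ} {i : Agent} :
    ∀ {s m : ℕ} {φ : Form Φ}, φ ∈ probes P q s m i → φ.Subjective i
  | _, 0, _, h => by simp [probes] at h
  | _, _ + 1, _, h => by
    obtain ⟨c, -, d, -, rfl⟩ := mem_probes_succ.1 h
    simp

/-- Any property of formulas that is stable under the connectives passes to state descriptions. -/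
theorem stateDescs_induction {C : Form Φ → Prop} {q : Φ} (atom : C (.atom q))
    (neg : ∀ α, C α → C (.neg α)) (or : ∀ α β, C α → C β → C (.or α β)) :
    ∀ {G : List (Form Φ)}, (∀ g ∈ G, C g) → ∀ d ∈ stateDescs q G, C d
  | [], _, d, hd => by
    obtain rfl : d = top q := by simpa [stateDescs] using hd
    exact or _ _ atom (neg _ atom)
  | g :: G, hG, d, hd => by
    have ih := stateDescs_induction atom neg or (G := G) fun g' hg' => hG g' (by simp [hg'])
    have hg := hG g (by simp)
    simp only [stateDescs, List.mem_append, List.mem_map] at hd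
    rcases hd with ⟨d', hd', rfl⟩ | ⟨d', hd', rfl⟩
    · exact neg _ (or _ _ (neg _ hg) (neg _ (ih d' hd')))
    · exact neg _ (or _ _ (neg _ (neg _ hg)) (neg _ (ih d' hd')))

theorem objective_of_mem_stateDescs {P : List Φ} {q : Φ} {s m : ℕ} {i : Agent} {d : Form Φ}
    (hd : d ∈ stateDescs q (cells P q s m i)) : d.Objective i := by
  refine stateDescs_induction (C := Objective i) trivial (fun _ h => h) (fun _ _ h h' => ⟨h, h'⟩)
    (fun g hg => ?_) d hd
  rcases List.mem_append.1 hg with hg | hg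
  · obtain ⟨p, -, rfl⟩ := List.mem_map.1 hg
    trivial
  · cases m with
    | zero => simp [probes] at hg
    | succ m =>
      obtain ⟨c, -, d, -, rfl⟩ := mem_probes_succ.1 hg
      simp

theorem mem_lang_of_mem_probes {P : List Φ} {q : Φ} :
    ∀ {m s : ℕ} {i : Agent} {φ : Form Φ}, φ ∈ probes P q s m i → φ ∈ Lang Φ s
  | 0, _, _, _, h => by simp [probes] at h
  | m + 1, s, i, φ, h => by
    obtain ⟨c, hc, d, hd, rfl⟩ := mem_probes_succ.1 h
    refine box_mem_lang (neg_mem_lang ?_) hc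
    refine stateDescs_induction (C := (· ∈ Lang Φ (s - 1))) (atom_mem_lang _ _)
      (fun _ => neg_mem_lang) (fun _ _ => or_mem_lang) (fun g hg => ?_) d hd
    rcases List.mem_append.1 hg with hg | hg
    · obtain ⟨p, -, rfl⟩ := List.mem_map.1 hg
      exact atom_mem_lang _ _
    · exact mem_lang_of_mem_probes hg

theorem mem_lang_of_mem_stateDescs {P : List Φ} {q : Φ} {s m : ℕ} {i : Agent} {d : Form Φ}
    (hd : d ∈ stateDescs q (cells P q s m i)) : d ∈ Lang Φ (s - 1) := by
  refine stateDescs_induction (C := (· ∈ Lang Φ (s - 1))) (atom_mem_lang _ _)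
    (fun _ => neg_mem_lang) (fun _ _ => or_mem_lang) (fun g hg => ?_) d hd
  rcases List.mem_append.1 hg with hg | hg
  · obtain ⟨p, -, rfl⟩ := List.mem_map.1 hg
    exact atom_mem_lang _ _
  · exact mem_lang_of_mem_probes hg

namespace Model

variable {X Y : Type*} (M : Model Φ X) (N : Model Φ Y)

theorem holds_and {x : X} {α β : Form Φ} :
    M.Holds x (and α β) ↔ M.Holds x α ∧ M.Holds x β := by
  simp only [Form.and, M.neg, M.or]; tauto

theorem exists_stateDesc (q : Φ) (x : X) :
    ∀ G : List (Form Φ), ∃ d ∈ stateDescs q G, M.Holds x d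
  | [] => ⟨top q, by simp [stateDescs], by simp only [top, M.neg, M.or]; tauto⟩
  | g :: G => by
    obtain ⟨d, hd, hx⟩ := exists_stateDesc q x G
    by_cases hg : M.Holds x g
    · exact ⟨and g d, List.mem_append_left _ (List.mem_map_of_mem hd), M.holds_and.2 ⟨hg, hx⟩⟩
    · exact ⟨and (.neg g) d, List.mem_append_right _ (List.mem_map_of_mem hd),
        M.holds_and.2 ⟨(M.neg _ _).2 hg, hx⟩⟩

variable {M N}

theorem agreeOn_of_stateDesc {q : Φ} {x : X} {y : Y} : ∀ {G : List (Form Φ)} {d : Form Φ},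
    d ∈ stateDescs q G → M.Holds x d → N.Holds y d → AgreeOn G (M.Holds x) (N.Holds y)
  | [], _, _, _, _ => by simp [AgreeOn]
  | g :: G, d, hd, hx, hy => by
    simp only [stateDescs, List.mem_append, List.mem_map] at hd
    rcases hd with ⟨d', hd', rfl⟩ | ⟨d', hd', rfl⟩ <;> rw [holds_and] at hx hy
    · have := agreeOn_of_stateDesc hd' hx.2 hy.2
      simpa [AgreeOn, hx.1, hy.1] using this
    · have := agreeOn_of_stateDesc hd' hx.2 hy.2
      rw [M.neg, N.neg] at *
      simpa [AgreeOn, hx.1, hy.1] using this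

theorem holds_stateDesc_iff {q : Φ} {x : X} {y : Y} : ∀ {G : List (Form Φ)},
    AgreeOn G (M.Holds x) (N.Holds y) →
    ∀ d ∈ stateDescs q G, (M.Holds x d ↔ N.Holds y d)
  | [], _, d, hd => by
    obtain rfl : d = top q := by simpa [stateDescs] using hd
    simp only [top, M.or, M.neg, N.or, N.neg]
    tauto
  | g :: G, h, d, hd => by
    have hg := h g (by simp)
    have ih := holds_stateDesc_iff (q := q) (G := G) fun g' hg' => h g' (by simp [hg'])
    simp only [stateDescs, List.mem_append, List.mem_map] at hd
    rcases hd with ⟨d', hd', rfl⟩ | ⟨d', hd', rfl⟩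
    · rw [holds_and, holds_and, hg, ih d' hd']
    · rw [holds_and, holds_and, M.neg, N.neg, hg, ih d' hd']

/-- Agreement on the probes of `i` gives the forth condition of a bisimulation for `i`. -/
theorem exists_rel_of_agreeOn {P : List Φ} {q : Φ} {s m : ℕ} {i : Agent} {c : Bool} {x x' : X}
    {y : Y} (hc : c = true → s ≠ 0)
    (h : AgreeOn (probes P q s (m + 1) i) (M.Holds x) (N.Holds y)) (hx : M.Rel c i x x') :
    ∃ y', N.Rel c i y y' ∧ AgreeOn (cells P q s m i) (M.Holds x') (N.Holds y') := by
  obtain ⟨d, hd, hxd⟩ := M.exists_stateDesc q x' (cells P q s m i)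
  have h1 : ¬ M.Holds x (Form.box c i (.neg d)) := fun hb =>
    (M.neg _ _).1 ((M.box _ _ _ _).1 hb x' hx) hxd
  rw [h _ (mem_probes_succ.2 ⟨c, hc, d, hd, rfl⟩), N.box] at h1
  push Not at h1
  obtain ⟨y', hy, hyd⟩ := h1
  rw [N.neg, not_not] at hyd
  exact ⟨y', hy, agreeOn_of_stateDesc hd hxd hyd⟩

/-- Agreement on the probes of both agents that are fine enough for `φ` gives agreement on `φ`. -/
theorem holds_iff_of_agreeOn {P : List Φ} {q : Φ} {φ : Form Φ} (hP : ∀ p ∈ φ.atoms, p ∈ P) :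
    ∀ {s m : Agent → ℕ} {x : X} {y : Y}, φ.Nest s → (∀ j, φ.need j ≤ m j) →
      (∀ p ∈ P, M.Holds x (atom p) ↔ N.Holds y (atom p)) →
      (∀ j, AgreeOn (probes P q (s j) (m j) j) (M.Holds x) (N.Holds y)) →
      (M.Holds x φ ↔ N.Holds y φ) := by
  induction φ using box_induction with
  | atom p => exact fun _ _ h _ => h p (hP p (by simp [atoms]))
  | neg α ih =>
    intro s m x y hs hm h0 h
    rw [M.neg, N.neg, ih hP hs hm h0 h]
  | or α β ih ih' =>
    intro s m x y hs hm h0 h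
    rw [M.or, N.or,
      ih (fun p hp => hP p (by simp [atoms, hp])) hs.1
        (fun j => (le_max_left _ _).trans (hm j)) h0 h,
      ih' (fun p hp => hP p (by simp [atoms, hp])) hs.2
        (fun j => (le_max_right _ _).trans (hm j)) h0 h]
  | box c i α ih =>
    intro s m x y hs hm h0 h
    rw [nest_box] at hs
    have hi := hm i
    rw [need_box_self] at hi
    obtain ⟨n, hn⟩ : ∃ n, m i = n + 1 := ⟨m i - 1, by omega⟩
    have hpi := h i
    rw [hn] at hpi
    -- Successors that agree on the cells satisfy the induction hypothesis, since successors
    -- inherit the subjective formulas of `i`.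
    have step : ∀ x' y', M.Rel c i x x' → N.Rel c i y y' →
        AgreeOn (cells P q (s i) n i) (M.Holds x') (N.Holds y') →
        (M.Holds x' α ↔ N.Holds y' α) := by
      intro x' y' hx hy hxy
      rw [agreeOn_cells] at hxy
      refine ih (fun p hp => hP p (by simpa using hp)) (m := Function.update m i.other n) hs.2
        (fun j => ?_) hxy.1 (fun j => ?_) <;>
      rcases i.eq_or_eq_other j with rfl | rfl
      · simp only [ne_eq, Agent.ne_other, not_false_eq_true, Function.update_of_ne]; omega
      · simp only [Function.update_self]; omega
      · simp only [ne_eq, Agent.ne_other, not_false_eq_true, Function.update_of_ne]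
        intro g hg
        have := subjective_of_mem_probes hg
        rw [← M.subj hx this, ← N.subj hy this]
        exact h j g hg
      · simpa only [Function.update_self] using hxy.2
    rw [M.box, N.box]
    constructor
    · intro hx y' hy
      obtain ⟨x', hx', hxy⟩ := exists_rel_of_agreeOn hs.1 hpi.symm hy
      exact (step x' y' hx' hy hxy.symm).1 (hx x' hx')
    · intro hy x' hx
      obtain ⟨y', hy', hxy⟩ := exists_rel_of_agreeOn hs.1 hpi hx
      exact (step x' y' hx hy' hxy).2 (hy y' hy')

end Model

/-! ### The model of all structures -/

/-- A structure of any level. -/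
abbrev Struct (Φ : Type u) := Σ k, EStruct Φ k

/-- The pairs in a structure (for `false`) or in its complement (for `true`). A structure of
level `0` has neither, which matches the dummy value that `Sat` gives to a modality there. -/
def Struct.side (c : Bool) : Struct Φ → Set (World Φ × Struct Φ)
  | ⟨0, _⟩ => ∅
  | ⟨k + 1, e⟩ => {v | ∃ x : EStruct Φ k, v.2 = ⟨k, x⟩ ∧ ((v.1, x) ∈ e.pairs ↔ c = false)}

theorem Struct.mem_side_succ {c : Bool} {k : ℕ} {e : EStruct Φ (k + 1)} {w : World Φ}
    {A : Struct Φ} : (w, A) ∈ Struct.side c ⟨k + 1, e⟩ ↔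
      ∃ x : EStruct Φ k, A = ⟨k, x⟩ ∧ ((w, x) ∈ e.pairs ↔ c = false) := Iff.rfl

/-- A structure for each agent, of any levels, together with a world. -/
@[ext]
structure Point (Φ : Type u) where
  /-- The structure of an agent. -/
  str : Agent → Struct Φ
  /-- The actual world. -/
  world : World Φ

namespace Point

/-- Truth at a point. -/
def Holds (x : Point Φ) (φ : Form Φ) : Prop := Sat φ (x.str .a).2 (x.str .b).2 x.world

/-- The points that a modality of `i` refers to: the structure of `i` is kept, the world and the
structure of the other agent come from the structure of `i`. -/
def Rel (c : Bool) (i : Agent) (x y : Point Φ) : Prop :=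
  y.str i = x.str i ∧ (y.world, y.str i.other) ∈ (x.str i).side c

/-- The point at which `i` has the structure `A`, the other agent has `B`, and `w` is the world. -/
def mk' (i : Agent) (A B : Struct Φ) (w : World Φ) : Point Φ :=
  ⟨fun j => if j = i then A else B, w⟩

@[simp] theorem mk'_str_self (i : Agent) (A B : Struct Φ) (w : World Φ) :
    (mk' i A B w).str i = A := by simp [mk']

@[simp] theorem mk'_str_other (i : Agent) (A B : Struct Φ) (w : World Φ) :
    (mk' i A B w).str i.other = B := by simp [mk']

@[simp] theorem mk'_world (i : Agent) (A B : Struct Φ) (w : World Φ) :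
    (mk' i A B w).world = w := rfl

theorem holds_box (c : Bool) (i : Agent) (x : Point Φ) (α : Form Φ) :
    x.Holds (.box c i α) ↔ ∀ y, Rel c i x y → y.Holds α := by
  have key : ∀ A B : Struct Φ, ∀ w,
      (mk' i A B w).Holds (.box c i α) ↔
        ∀ v ∈ A.side c, (mk' i A v.2 v.1).Holds α := by
    rintro ⟨_ | k, e⟩ B w <;> cases i <;> cases c <;>
      simp [Form.box, Holds, mk', Sat, Struct.side] <;> grind
  have hx : x = mk' i (x.str i) (x.str i.other) x.world := by
    ext j : 2
    · rcases i.eq_or_eq_other j with rfl | rfl <;> simp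
    · rfl
  rw [hx, key, ← hx]
  constructor
  · rintro h y ⟨h1, h2⟩
    have hy : y = mk' i (x.str i) (y.str i.other) y.world := by
      ext j : 2
      · rcases i.eq_or_eq_other j with rfl | rfl <;> simp [h1]
      · rfl
    rw [hy]
    exact h _ h2
  · exact fun h v hv => h _ ⟨by simp, by simpa using hv⟩

theorem holds_neg (x : Point Φ) (α : Form Φ) : x.Holds (.neg α) ↔ ¬ x.Holds α := Iff.rfl

theorem holds_or (x : Point Φ) (α β : Form Φ) : x.Holds (.or α β) ↔ x.Holds α ∨ x.Holds β :=
  Iff.rfl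

theorem holds_iff_of_subjective {i : Agent} {x y : Point Φ} (h : x.str i = y.str i) {σ : Form Φ}
    (hσ : σ.Subjective i) : x.Holds σ ↔ y.Holds σ := by
  induction σ using box_induction with
  | atom p => exact hσ.elim
  | neg α ih => rw [holds_neg, holds_neg, ih hσ]
  | or α β ih ih' => rw [holds_or, holds_or, ih hσ.1, ih' hσ.2]
  | box c j α _ =>
    obtain rfl : j = i := by simpa using hσ
    simp only [holds_box, Rel, h]

theorem holds_iff_of_objective {i : Agent} {x y : Point Φ} (h : x.str i.other = y.str i.other)
    (hw : x.world = y.world) {σ : Form Φ} (hσ : σ.Objective i) : x.Holds σ ↔ y.Holds σ := by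
  induction σ using box_induction with
  | atom p => simp only [Holds, Sat, hw]
  | neg α ih => rw [holds_neg, holds_neg, ih hσ]
  | or α β ih ih' => rw [holds_or, holds_or, ih hσ.1, ih' hσ.2]
  | box c j α _ =>
    obtain rfl : j = i.other := Agent.eq_other_of_ne (by simpa using hσ)
    exact holds_iff_of_subjective h (by simp)

theorem Rel.level {c : Bool} {i : Agent} {x y : Point Φ} (h : Rel c i x y) :
    (x.str i).1 = (y.str i.other).1 + 1 := by
  obtain ⟨-, h⟩ := h
  generalize x.str i = A at h
  rcases A with ⟨_ | k, e⟩
  · exact h.elim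
  · obtain ⟨z, hz, -⟩ := Struct.mem_side_succ.1 h
    rw [hz]

/-- Every pair of the right level lies in the structure of `i` or in its complement. -/
theorem exists_rel {i : Agent} {x : Point Φ} {B : Struct Φ} {w : World Φ}
    (h : (x.str i).1 = B.1 + 1) : ∃ c, Rel c i x (mk' i (x.str i) B w) := by
  obtain ⟨⟨n, e⟩, hA⟩ : ∃ A, x.str i = A := ⟨_, rfl⟩
  obtain ⟨k, z⟩ := B
  obtain rfl := (congrArg Sigma.fst hA).symm.trans h
  by_cases hz : (w, z) ∈ e.pairs
  · exact ⟨false, by simp [hA], by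
      rw [hA]; simpa using Struct.mem_side_succ.2 ⟨z, rfl, iff_of_true hz rfl⟩⟩
  · exact ⟨true, by simp [hA], by
      rw [hA]; simpa using Struct.mem_side_succ.2 ⟨z, rfl, iff_of_false hz (by simp)⟩⟩

end Point

/-- The points of all levels form an introspective model. -/
def pointModel (Φ : Type u) : Model Φ (Point Φ) where
  Holds := Point.Holds
  Rel := Point.Rel
  neg := Point.holds_neg
  or := Point.holds_or
  box := Point.holds_box
  subj h _ hσ := Point.holds_iff_of_subjective h.1.symm hσ

/-! ### Realizing nodes by structures -/

/-- The points at which `i` has the structure `A` agree with `T` on the probes of `i`. -/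
def Realizes (P : List Φ) (q : Φ) (s m : ℕ) (i : Agent) (A : Struct Φ) (T : Form Φ → Prop) :
    Prop :=
  ∀ x : Point Φ, x.str i = A → AgreeOn (probes P q s m i) x.Holds T

theorem realizes_zero {P : List Φ} {q : Φ} {s : ℕ} {i : Agent} {A : Struct Φ}
    {T : Form Φ → Prop} : Realizes P q s 0 i A T := by
  intro x _ g hg
  simp [probes] at hg

theorem realizes_of_agreeOn {P : List Φ} {q : Φ} {s m : ℕ} {i : Agent} {x : Point Φ}
    {T : Form Φ → Prop} (h : AgreeOn (probes P q s m i) x.Holds T) :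
    Realizes P q s m i (x.str i) T := by
  intro y hy g hg
  rw [Point.holds_iff_of_subjective hy (subjective_of_mem_probes hg)]
  exact h g hg

instance (k : ℕ) : Nonempty (EStruct Φ k) := by
  cases k
  · exact ⟨PUnit.unit⟩
  · exact ⟨(∅ : Set _)⟩

/-- A node `x` is realized by a structure of level `k + 1` if its successors are realized at
level `k` and, where the probes mention `N`, every pair that can occur in such a structure looks
like some successor of `x`. A pair that looks like an `L`-successor and also like an `N`-successor
must not be lost for either of them; a spare atom `q`, invisible to the probes, yields two copies
of it, one for the structure and one for the complement. -/
theorem exists_realizes_succ {X : Type*} {M : Model Φ X} {P : List Φ} {q : Φ} (hq : q ∉ P)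
    {s m k : ℕ} {i : Agent} {x : X}
    (hsucc : ∀ c y, (c = true → s ≠ 0) → M.Rel c i x y →
      ∃ z : EStruct Φ k, Realizes P q (s - 1) m i.other ⟨k, z⟩ (M.Holds y))
    (hcov : s ≠ 0 → ∀ (w : World Φ) (z : EStruct Φ k), ∃ c y, M.Rel c i x y ∧
      (∀ p ∈ P, p ∈ w ↔ M.Holds y (.atom p)) ∧
      Realizes P q (s - 1) m i.other ⟨k, z⟩ (M.Holds y)) :
    ∃ e : EStruct Φ (k + 1), Realizes P q s (m + 1) i ⟨k + 1, e⟩ (M.Holds x) := by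
  set Like : Bool → World Φ → EStruct Φ k → Prop := fun c w z => ∃ y, M.Rel c i x y ∧
    (∀ p ∈ P, p ∈ w ↔ M.Holds y (.atom p)) ∧
    Realizes P q (s - 1) m i.other ⟨k, z⟩ (M.Holds y)
  -- The pairs that look like successors of both kinds are divided according to the atom `q`.
  obtain ⟨e, he⟩ : ∃ e : EStruct Φ (k + 1), ∀ w z, (w, z) ∈ e.pairs ↔
      Like false w z ∧ (s = 0 ∨ ¬ Like true w z ∨ q ∈ w) :=
    ⟨{v | Like false v.1 v.2 ∧ (s = 0 ∨ ¬ Like true v.1 v.2 ∨ q ∈ v.1)}, fun _ _ => Iff.rfl⟩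
  have hback : ∀ c w z, (c = true → s ≠ 0) → ((w, z) ∈ e.pairs ↔ c = false) → Like c w z := by
    intro c w z hc h
    cases c with
    | false => exact ((he w z).1 (h.2 rfl)).1
    | true =>
      have hs := hc rfl
      have h' : (w, z) ∉ e.pairs := fun hv => by simpa using h.1 hv
      by_contra hn
      obtain ⟨c, hy⟩ := hcov hs w z
      cases c with
      | false => exact h' ((he w z).2 ⟨hy, Or.inr (Or.inl hn)⟩)
      | true => exact hn hy
  have hforth : ∀ c y, (c = true → s ≠ 0) → M.Rel c i x y → ∃ w z,
      ((w, z) ∈ e.pairs ↔ c = false) ∧ (∀ p ∈ P, p ∈ w ↔ M.Holds y (.atom p)) ∧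
      Realizes P q (s - 1) m i.other ⟨k, z⟩ (M.Holds y) := by
    intro c y hc hy
    obtain ⟨z, hz⟩ := hsucc c y hc hy
    cases c with
    | false =>
      have hw : ∀ p ∈ P, p ∈ insert q {p | M.Holds y (.atom p)} ↔ M.Holds y (.atom p) :=
        fun p hp => by simp [ne_of_mem_of_not_mem hp hq]
      exact ⟨_, z, iff_of_true ((he _ _).2 ⟨⟨y, hy, hw, hz⟩, Or.inr (Or.inr (by simp))⟩) rfl, hw, hz⟩
    | true =>
      have hw : ∀ p ∈ P, p ∈ {p | M.Holds y (.atom p)} \ {q} ↔ M.Holds y (.atom p) :=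
        fun p hp => by simp [ne_of_mem_of_not_mem hp hq]
      refine ⟨_, z, iff_of_false (fun hv => ?_) (by simp), hw, hz⟩
      rcases ((he _ _).1 hv).2 with h | h | h
      · exact hc rfl h
      · exact h ⟨y, hy, hw, hz⟩
      · simp at h
  have hagree : ∀ (y : X) (v : Point Φ), (∀ p ∈ P, p ∈ v.world ↔ M.Holds y (.atom p)) →
      AgreeOn (probes P q (s - 1) m i.other) v.Holds (M.Holds y) →
      ∀ d ∈ stateDescs q (cells P q s m i), (v.Holds d ↔ M.Holds y d) :=
    fun y v hP hv => Model.holds_stateDesc_iff (M := pointModel Φ) (agreeOn_cells.2 ⟨hP, hv⟩)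
  refine ⟨e, fun v hv g hg => ?_⟩
  obtain ⟨c, hc, d, hd, rfl⟩ := mem_probes_succ.1 hg
  rw [Point.holds_box, M.box]
  constructor
  · intro h y hy
    obtain ⟨w, z, hwz, hP, hz⟩ := hforth c y hc hy
    have h1 := h (Point.mk' i (v.str i) ⟨k, z⟩ w)
      ⟨by simp, by rw [hv]; simpa using Struct.mem_side_succ.2 ⟨z, rfl, hwz⟩⟩
    rw [M.neg, ← hagree y (Point.mk' i (v.str i) ⟨k, z⟩ w) hP (hz _ (by simp)) d hd]
    exact h1
  · rintro h v' ⟨-, hv'⟩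
    rw [hv] at hv'
    obtain ⟨z, hz, hwz⟩ := Struct.mem_side_succ.1 hv'
    obtain ⟨y, hy, hP, hyz⟩ := hback c _ _ hc hwz
    have h1 := h y hy
    rw [M.neg, ← hagree y v' hP (hyz v' hz) d hd] at h1
    exact h1

/-- The structures of different levels `k` and `k'` realize the same probes of depth
at most `k` and `k'`. -/
theorem exists_realizes_of_le_level {P : List Φ} {q : Φ} (hq : q ∉ P) :
    ∀ {m : ℕ} (s : ℕ) (i : Agent) {k' : ℕ} (x : Point Φ), m ≤ (x.str i).1 → m ≤ k' →
      ∃ e : EStruct Φ k', Realizes P q s m i ⟨k', e⟩ x.Holds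
  | 0, _, _, k', _, _, _ => ⟨Classical.arbitrary _, realizes_zero⟩
  | m + 1, s, i, k' + 1, x, hk, hk' => by
    refine exists_realizes_succ (M := pointModel Φ) hq (fun c y _ hy => ?_) (fun _ w z => ?_)
    · exact exists_realizes_of_le_level hq (s - 1) i.other y
        (by have := Point.Rel.level hy; omega) (Nat.le_of_succ_le_succ hk')
    · obtain ⟨k, hxk⟩ : ∃ k, (x.str i).1 = k + 1 := ⟨(x.str i).1 - 1, by omega⟩
      let y : Point Φ := Point.mk' i.other ⟨k', z⟩ ⟨k', z⟩ w
      obtain ⟨z', hz'⟩ := exists_realizes_of_le_level hq (k' := k) (s - 1) i.other y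
        (by simpa [y] using Nat.le_of_succ_le_succ hk') (by omega)
      obtain ⟨c, hc⟩ := Point.exists_rel (w := w) (B := ⟨k, z'⟩) hxk
      refine ⟨c, _, hc, fun p _ => Iff.rfl, ?_⟩
      have := realizes_of_agreeOn (hz' (Point.mk' i (x.str i) ⟨k, z'⟩ w) (by simp)).symm
      simp only [y, Point.mk'_str_self] at this
      exact this

/-- The satisfiability of a formula does not depend on the levels of the structures, once these
are large enough. -/
theorem exists_holds_of_le_level [Infinite Φ] {φ : Form Φ} {x : Point Φ} (hx : x.Holds φ)
    (hk : ∀ i, φ.need i ≤ (x.str i).1) {k : Agent → ℕ} (hk' : ∀ i, φ.need i ≤ k i) :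
    ∃ y : Point Φ, (∀ i, (y.str i).1 = k i) ∧ y.Holds φ := by
  classical
  obtain ⟨q, hq⟩ := Infinite.exists_notMem_finset φ.atoms.toFinset
  rw [List.mem_toFinset] at hq
  choose e he using fun i =>
    exists_realizes_of_le_level hq (φ.need i) i (k' := k i) x (hk i) (hk' i)
  let y : Point Φ := ⟨fun i => ⟨k i, e i⟩, x.world⟩
  refine ⟨y, fun _ => rfl, ?_⟩
  exact (Model.holds_iff_of_agreeOn (M := pointModel Φ) (N := pointModel Φ) (fun p hp => hp)
    (nest_of_need_le fun _ => le_rfl) (fun _ => le_rfl) (x := y) (y := x)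
    (fun p _ => Iff.rfl) fun j => he j y rfl).2 hx

/-- Truth at all points of sufficiently large levels. -/
def EventuallyValid (φ : Form Φ) : Prop :=
  ∃ K : ℕ, ∀ x : Point Φ, (∀ i, K ≤ (x.str i).1) → x.Holds φ

/-- An eventually valid formula is true at all points of the levels that it needs. -/
theorem EventuallyValid.holds [Infinite Φ] {φ : Form Φ} (h : EventuallyValid φ) {x : Point Φ}
    (hx : ∀ i, φ.need i ≤ (x.str i).1) : x.Holds φ := by
  obtain ⟨K, hK⟩ := h
  by_contra hn
  obtain ⟨y, hy, hyn⟩ := exists_holds_of_le_level (φ := .neg φ) hn hx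
    (k := fun i => max K (φ.need i)) fun _ => le_max_right _ _
  exact hyn (hK y fun i => by simp [hy])

theorem EventuallyValid.valid [Infinite Φ] {φ : Form Φ} (h : EventuallyValid φ) : Valid φ := by
  intro ea eb w
  let x : Point Φ := ⟨fun | .a => ⟨_, ea⟩ | .b => ⟨_, eb⟩, w⟩
  refine h.holds (x := x) fun i => ?_
  cases i
  · exact (need_add_one_le_depth φ .a).1
  · exact (need_add_one_le_depth φ .b).1

/-! ### The canonical model -/

/-- Derivability from the premises `Γ`, to which necessitation may not be applied. -/
inductive DerivesFrom (A Γ : Set (Form Φ)) : Form Φ → Prop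
  | prem {α : Form Φ} : α ∈ Γ → DerivesFrom A Γ α
  | thm {α : Form Φ} : Derives A α → DerivesFrom A Γ α
  | mp {α β : Form Φ} : DerivesFrom A Γ (.imp α β) → DerivesFrom A Γ α → DerivesFrom A Γ β

namespace DerivesFrom

variable {A Γ : Set (Form Φ)} {α β γ : Form Φ}

theorem taut (h : Tautology α) : DerivesFrom A Γ α := .thm (.ax1 h)

theorem mono {Δ : Set (Form Φ)} (hs : Γ ⊆ Δ) (h : DerivesFrom A Γ α) : DerivesFrom A Δ α := by
  induction h with
  | prem h => exact .prem (hs h)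
  | thm h => exact .thm h
  | mp _ _ ih ih' => exact .mp ih ih'

theorem deduction (h : DerivesFrom A (insert α Γ) β) : DerivesFrom A Γ (.imp α β) := by
  induction h with
  | @prem β h =>
    rcases h with rfl | h
    · exact taut fun v hn ho => by simp only [imp, hn, ho]; tauto
    · exact .mp (taut fun v hn ho => by simp only [imp, hn, ho]; tauto) (.prem h)
  | @thm β h => exact .mp (taut fun v hn ho => by simp only [imp, hn, ho]; tauto) (.thm h)
  | @mp β γ _ _ ih ih' =>
    exact .mp (.mp (taut (α := .imp (.imp α (.imp β γ)) (.imp (.imp α β) (.imp α γ)))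
      fun v hn ho => by simp only [imp, hn, ho]; tauto) ih) ih'

theorem of_empty (h : DerivesFrom A ∅ α) : Derives A α := by
  induction h with
  | prem h => exact h.elim
  | thm h => exact h
  | mp _ _ ih ih' => exact .mp ih ih'

theorem exists_of_sUnion {C : Set (Set (Form Φ))} (hC : IsChain (· ⊆ ·) C) (hne : C.Nonempty)
    (h : DerivesFrom A (⋃₀ C) α) : ∃ Γ ∈ C, DerivesFrom A Γ α := by
  induction h with
  | prem h => exact ⟨_, h.choose_spec.1, .prem h.choose_spec.2⟩
  | thm h => exact ⟨_, hne.choose_spec, .thm h⟩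
  | mp _ _ ih ih' =>
    obtain ⟨Γ, hΓ, h⟩ := ih
    obtain ⟨Δ, hΔ, h'⟩ := ih'
    rcases hC.total hΓ hΔ with hs | hs
    · exact ⟨Δ, hΔ, .mp (h.mono hs) h'⟩
    · exact ⟨Γ, hΓ, .mp h (h'.mono hs)⟩

end DerivesFrom

/-- Maximal consistent sets of formulas. -/
structure IsMaxConsistent (A Γ : Set (Form Φ)) : Prop where
  thm : ∀ {α}, Derives A α → α ∈ Γ
  mp : ∀ {α β}, .imp α β ∈ Γ → α ∈ Γ → β ∈ Γ
  neg : ∀ {α}, .neg α ∈ Γ ↔ α ∉ Γ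

/-- A set of premises from which `φ` is not derivable has a maximal consistent extension that
contains `¬ φ`. -/
theorem exists_isMaxConsistent {A Γ : Set (Form Φ)} {φ : Form Φ} (h : ¬ DerivesFrom A Γ φ) :
    ∃ Δ, Γ ⊆ Δ ∧ .neg φ ∈ Δ ∧ IsMaxConsistent A Δ := by
  obtain ⟨Δ, hΓΔ, hmax⟩ := zorn_subset_nonempty {Δ | ¬ DerivesFrom A Δ φ} (fun C hCs hC hne =>
    ⟨⋃₀ C, fun hd => by
      obtain ⟨Δ, hΔ, hd⟩ := hd.exists_of_sUnion hC hne
      exact hCs hΔ hd, fun _ => Set.subset_sUnion_of_mem⟩) Γ h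
  have hΔ : ¬ DerivesFrom A Δ φ := hmax.prop
  have himp : ∀ {ψ}, ψ ∉ Δ → DerivesFrom A Δ (.imp ψ φ) := fun {ψ} hψ => by
    by_contra hn
    have : ¬ DerivesFrom A (insert ψ Δ) φ := fun hd => hn hd.deduction
    exact hψ (hmax.le_of_ge this (Set.subset_insert _ _) (Set.mem_insert _ _))
  have hclosed : ∀ {ψ}, DerivesFrom A Δ ψ → ψ ∈ Δ := fun hψ => by
    by_contra hn
    exact hΔ (.mp (himp hn) hψ)
  have hneg : ∀ {ψ}, .neg ψ ∈ Δ ↔ ψ ∉ Δ := fun {ψ} => by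
    constructor
    · refine fun hn hψ => hΔ (.mp (.mp (.taut (α := .imp (.neg ψ) (.imp ψ φ)) ?_)
        (.prem hn)) (.prem hψ))
      intro v hn ho
      simp only [imp, hn, ho]
      tauto
    · intro hψ
      by_contra hn
      refine hΔ (.mp (.mp (.taut (α := .imp (.imp ψ φ) (.imp (.imp (.neg ψ) φ) φ)) ?_)
        (himp hψ)) (himp hn))
      intro v hn ho
      simp only [imp, hn, ho]
      tauto
  exact ⟨Δ, hΓΔ, hneg.2 fun hφ => hΔ (.prem hφ),
    fun h => hclosed (.thm h), fun h h' => hclosed (.mp (.prem h) (.prem h')), hneg⟩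

theorem Derives.nec {A : Set (Form Φ)} {α : Form Φ} (c : Bool) (i : Agent) (h : Derives A α) :
    Derives A (box c i α) := by
  cases c
  · exact .necL i h
  · exact .necN i h

theorem Derives.distr (A : Set (Form Φ)) (c : Bool) (i : Agent) (α β : Form Φ) :
    Derives A (.imp (box c i (.imp α β)) (.imp (box c i α) (box c i β))) := by
  cases c
  · exact .ax2 i α β
  · exact .ax3 i α β

theorem Derives.of_taut {A : Set (Form Φ)} {α β : Form Φ} (ht : Tautology (.imp α β))
    (h : Derives A α) : Derives A β := .mp (.ax1 ht) h

theorem Derives.introspection (A : Set (Form Φ)) (c : Bool) (i : Agent) {σ : Form Φ}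
    (hσ : σ.Subjective i) : Derives A (.imp σ (box c i σ)) := by
  refine .of_taut ?_ (.ax4 i hσ)
  intro v hn ho
  cases c <;> simp only [imp, Form.and, Form.box, hn, ho] <;> tauto

namespace IsMaxConsistent

variable {A Γ : Set (Form Φ)} {α β : Form Φ}

theorem or (h : IsMaxConsistent A Γ) : .or α β ∈ Γ ↔ α ∈ Γ ∨ β ∈ Γ := by
  constructor
  · intro ho
    by_contra! hn
    have : Derives A (.imp (.or α β) (.imp (.neg α) β)) :=
      .ax1 fun v hn ho => by simp only [imp, hn, ho]; tauto
    exact hn.2 (h.mp (h.mp (h.thm this) ho) (h.neg.2 hn.1))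
  · rintro (hα | hα)
    · exact h.mp (h.thm (.ax1 fun v hn ho => by simp only [imp, hn, ho]; tauto)) hα
    · exact h.mp (h.thm (.ax1 fun v hn ho => by simp only [imp, hn, ho]; tauto)) hα

theorem box (h : IsMaxConsistent A Γ) (c : Bool) (i : Agent) : box c i α ∈ Γ ↔
    ∀ Δ, IsMaxConsistent A Δ → (∀ β, Form.box c i β ∈ Γ → β ∈ Δ) → α ∈ Δ := by
  refine ⟨fun hα Δ _ hΔ => hΔ α hα, fun hα => ?_⟩
  have key : ∀ {β}, DerivesFrom A {β | Form.box c i β ∈ Γ} β → Form.box c i β ∈ Γ := by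
    intro β hβ
    induction hβ with
    | prem h => exact h
    | thm hd => exact h.thm (hd.nec c i)
    | mp _ _ ih ih' => exact h.mp (h.mp (h.thm (.distr A c i _ _)) ih) ih'
  by_contra hn
  obtain ⟨Δ, hs, hnα, hΔ⟩ := exists_isMaxConsistent fun hd => hn (key hd)
  exact hΔ.neg.1 hnα (hα Δ hΔ hs)

end IsMaxConsistent

/-- The maximal consistent sets form an introspective model. -/
def canonicalModel (A : Set (Form Φ)) : Model Φ {Γ // IsMaxConsistent A Γ} where
  Holds Γ α := α ∈ Γ.1
  Rel c i Γ Δ := ∀ α, box c i α ∈ Γ.1 → α ∈ Δ.1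
  neg Γ _ := Γ.2.neg
  or Γ _ _ := Γ.2.or
  box c i Γ α := by simp only [Subtype.forall]; exact Γ.2.box c i
  subj {c i Γ Δ} h σ hσ := by
    refine ⟨fun hm => h _ (Γ.2.mp (Γ.2.thm (.introspection A c i hσ)) hm), fun hm => ?_⟩
    by_contra hn
    have hσ' : (Form.neg σ).Subjective i := hσ
    exact Δ.2.neg.1 (h _ (Γ.2.mp (Γ.2.thm (.introspection A c i hσ')) (Γ.2.neg.2 hn))) hm

/-! ### Conservativity over K45 -/

/-- Replace all modalities `N i` by `L i`. -/
def Form.dropN : Form Φ → Form Φ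
  | atom p => atom p
  | neg α => neg α.dropN
  | or α β => or α.dropN β.dropN
  | L i α => L i α.dropN
  | N i α => L i α.dropN

theorem Form.basic_dropN (α : Form Φ) : α.dropN.Basic := by
  induction α with
  | atom p => exact fun _ h => h
  | neg α ih => exact ih
  | or α β ih ih' => exact fun i h => h.elim (ih i) (ih' i)
  | L i α ih => exact ih
  | N i α ih => exact ih

theorem Form.Basic.dropN_eq {α : Form Φ} (h : α.Basic) : α.dropN = α := by
  induction α with
  | atom p => rfl
  | neg α ih => exact congrArg _ (ih h)
  | or α β ih ih' =>
    exact congrArg₂ _ (ih fun i hi => h i (Or.inl hi)) (ih' fun i hi => h i (Or.inr hi))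
  | L i α ih => exact congrArg _ (ih h)
  | N i α ih => exact absurd (Or.inl rfl) (h i)

theorem Form.Subjective.dropN {i : Agent} {α : Form Φ} (h : α.Subjective i) :
    α.dropN.Subjective i := by
  induction α with
  | atom p => exact h
  | neg α ih => exact ih h
  | or α β ih ih' => exact ⟨ih h.1, ih' h.2⟩
  | L j α ih => exact h
  | N j α ih => exact h

/-- Provability in K45 once all modalities `N i` are replaced by `L i`; since the replacement
yields a basic formula, the restriction of K45 to basic formulas needs no attention. -/
def DropK45 (α : Form Φ) : Prop := K45 α.dropN

namespace DropK45

variable {α β γ : Form Φ}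

theorem taut (h : Tautology α) : DropK45 α :=
  K45.taut (basic_dropN α) fun v hn ho =>
    h (fun β => v β.dropN) (fun β => hn β.dropN) fun β γ => ho β.dropN γ.dropN

theorem mp (h : DropK45 (.imp α β)) (h' : DropK45 α) : DropK45 β := K45.mp h h'

theorem imp_trans (h : DropK45 (.imp α β)) (h' : DropK45 (.imp β γ)) : DropK45 (.imp α γ) := by
  refine mp (mp (taut (α := .imp (.imp α β) (.imp (.imp β γ) (.imp α γ))) ?_) h) h'
  intro v hn ho
  simp only [imp, hn, ho]
  tauto

theorem distr (i : Agent) (α β : Form Φ) :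
    DropK45 (.imp (.L i (.imp α β)) (.imp (.L i α) (.L i β))) :=
  K45.distr i (basic_dropN α) (basic_dropN β)

theorem L_imp (i : Agent) (h : DropK45 (.imp α β)) : DropK45 (.imp (.L i α) (.L i β)) :=
  mp (distr i α β) (K45.nec i h)

theorem four (i : Agent) (α : Form Φ) : DropK45 (.imp (.L i α) (.L i (.L i α))) :=
  K45.four i (basic_dropN α)

theorem five (i : Agent) (α : Form Φ) : DropK45 (.imp (.neg (.L i α)) (.L i (.neg (.L i α)))) :=
  K45.five i (basic_dropN α)

/-- Introspection for all Boolean combinations of modal formulas of one agent. -/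
theorem introspection (i : Agent) : ∀ {σ : Form Φ}, σ.Subjective i →
    DropK45 (.imp σ (.L i σ)) ∧ DropK45 (.imp (.neg σ) (.L i (.neg σ)))
  | .atom _, h => h.elim
  | .neg σ, h => by
    obtain ⟨h1, h2⟩ := introspection (σ := σ) i h
    refine ⟨h2, imp_trans (taut ?_) (imp_trans h1 (L_imp i (taut ?_)))⟩ <;>
    · intro v hn ho
      simp only [imp, hn, ho]
      tauto
  | .or σ τ, h => by
    obtain ⟨h1, h2⟩ := introspection i h.1
    obtain ⟨h1', h2'⟩ := introspection i h.2
    constructor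
    · have e1 : DropK45 (.imp σ (.L i (.or σ τ))) := imp_trans h1 (L_imp i (taut
        fun v hn ho => by simp only [imp, hn, ho]; tauto))
      have e2 : DropK45 (.imp τ (.L i (.or σ τ))) := imp_trans h1' (L_imp i (taut
        fun v hn ho => by simp only [imp, hn, ho]; tauto))
      refine mp (mp (taut ?_) e1) e2
      intro v hn ho
      simp only [imp, hn, ho]
      tauto
    · have e : DropK45 (.imp (.L i (.neg σ))
          (.imp (.L i (.neg τ)) (.L i (.neg (.or σ τ))))) :=
        imp_trans (L_imp i (taut (fun v hn ho => by simp only [imp, hn, ho]; tauto))) (distr i _ _)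
      refine mp (mp (mp (taut ?_) h2) h2') e
      intro v hn ho
      simp only [imp, hn, ho]
      tauto
  | .L _ α, h => by
    obtain rfl := h
    exact ⟨four _ α, five _ α⟩
  | .N _ α, h => by
    obtain rfl := h
    exact ⟨four _ α, five _ α⟩

theorem of_derives {α : Form Φ} (h : Derives ∅ α) : DropK45 α := by
  induction h with
  | ax1 h => exact taut h
  | ax2 i α β => exact distr i α β
  | ax3 i α β => exact distr i α β
  | @ax4 i σ hσ =>
    have hL : DropK45 (.imp σ (.L i σ)) := (introspection i hσ).1
    have hN : DropK45 (.imp σ (.N i σ)) := hL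
    refine mp (mp (taut ?_) hL) hN
    intro v hn ho
    simp only [imp, Form.and, hn, ho]
    tauto
  | ax5 h => exact h.elim
  | mp _ _ ih ih' => exact ih.mp ih'
  | necL i _ ih => exact K45.nec i ih
  | necN i _ ih => exact K45.nec i ih

end DropK45

theorem K45.derives {α : Form Φ} (A : Set (Form Φ)) (h : K45 α) : Derives A α := by
  induction h with
  | taut _ ht => exact .ax1 ht
  | distr i _ _ => exact .ax2 i _ _
  | four i _ => exact .introspection A false i (by rfl)
  | five i _ => exact .introspection A false i (by rfl)
  | mp _ _ ih ih' => exact .mp ih ih'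
  | nec i _ ih => exact .necL i ih

/-- Without A5 the axioms are conservative over K45. -/
theorem k45_iff_derives {α : Form Φ} (h : α.Basic) : K45 α ↔ Derives (A5 Φ 0) α := by
  refine ⟨K45.derives _, fun hd => ?_⟩
  have : K45 α.dropN := DropK45.of_derives hd
  rwa [h.dropN_eq] at this

/-! ### Soundness -/

/-- A description of the axioms A5 in which K45 appears as the system of index `0`. -/
theorem mem_A5_iff {γ : Form Φ} : ∀ {t : ℕ}, γ ∈ A5 Φ t ↔
    ∃ s < t, ∃ i α, γ = .imp (.N i α) (.neg (.L i α)) ∧ .neg α ∈ Lang Φ s ∧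
      (neg α).Objective i ∧ Consistent (Derives (A5 Φ s)) (.neg α)
  | 0 => by simp [A5]
  | 1 => by
    simp only [A5, Nat.lt_one_iff, exists_eq_left, Set.mem_ofPred_eq, Lang]
    refine exists_congr fun i => exists_congr fun α => and_congr_right fun _ =>
      and_congr_right fun h => and_congr_right fun _ => not_congr ?_
    exact k45_iff_derives (α := .neg (.neg α)) h
  | t + 2 => by
    have ih := mem_A5_iff (γ := γ) (t := t + 1)
    simp only [A5, Set.mem_union, Set.mem_ofPred_eq] at ih ⊢
    rw [ih]
    constructor
    · rintro (⟨s, hs, h⟩ | h)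
      · exact ⟨s, hs.trans (Nat.lt_succ_self _), h⟩
      · exact ⟨t + 1, Nat.lt_succ_self _, h⟩
    · rintro ⟨s, hs, h⟩
      rcases Nat.lt_succ_iff_lt_or_eq.1 hs with hs | rfl
      · exact Or.inl ⟨s, hs, h⟩
      · exact Or.inr h

/-- The structures of every level `k ≥ m` realize the maximal consistent sets of index `t`, provided
that the systems of smaller index are sound. The axioms A5 are what covers all pairs that can
occur in a structure: a state description that is true at such a pair is consistent by soundness,
so its negation is not both `L i`-necessary and `N i`-necessary. -/
theorem exists_realizes_of_isMaxConsistent [Infinite Φ] {t : ℕ}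
    (hsound : ∀ s < t, ∀ φ, Derives (A5 Φ s) φ → EventuallyValid φ) {P : List Φ} {q : Φ}
    (hq : q ∉ P) : ∀ {m s k : ℕ} (i : Agent) (Γ : {Γ // IsMaxConsistent (A5 Φ t) Γ}),
      s ≤ t → m ≤ k →
      ∃ e : EStruct Φ k, Realizes P q s m i ⟨k, e⟩ ((canonicalModel (A5 Φ t)).Holds Γ)
  | 0, _, _, _, _, _, _ => ⟨Classical.arbitrary _, realizes_zero⟩
  | m + 1, s, k + 1, i, Γ, hs, hk => by
    have hk : m ≤ k := Nat.le_of_succ_le_succ hk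
    refine exists_realizes_succ hq (fun c Δ _ _ =>
      exists_realizes_of_isMaxConsistent hsound hq i.other Δ ((Nat.sub_le s 1).trans hs) hk)
      fun hs0 w z => ?_
    let v : Point Φ := Point.mk' i ⟨k, z⟩ ⟨k, z⟩ w
    obtain ⟨d, hd, hvd⟩ := (pointModel Φ).exists_stateDesc q v (cells P q s m i)
    have hcons : Consistent (Derives (A5 Φ (s - 1))) (.neg (.neg d)) := by
      intro hn
      obtain ⟨K, hK⟩ := hsound _ (by omega) _ hn
      obtain ⟨z', hz'⟩ := exists_realizes_of_le_level hq (k' := max K m) (s - 1) i.other v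
        (by simpa [v] using hk) (le_max_right _ _)
      let v' : Point Φ := Point.mk' i ⟨max K m, z'⟩ ⟨max K m, z'⟩ w
      have hv' : v'.Holds (.neg (.neg (.neg d))) := hK v' fun j => by
        rcases i.eq_or_eq_other j with rfl | rfl <;> simp [v']
      have hagree : v'.Holds d ↔ v.Holds d :=
        Model.holds_stateDesc_iff (M := pointModel Φ) (N := pointModel Φ) (x := v') (y := v)
          (agreeOn_cells.2 ⟨fun _ _ => Iff.rfl, hz' v' (by simp [v'])⟩) d hd
      exact hv' (not_not.2 (hagree.2 hvd))
    have hax : .imp (.N i (.neg d)) (.neg (.L i (.neg d))) ∈ A5 Φ t :=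
      mem_A5_iff.2 ⟨s - 1, by omega, i, .neg d, rfl,
        neg_mem_lang (neg_mem_lang (mem_lang_of_mem_stateDescs hd)),
        objective_of_mem_stateDescs (d := d) hd, hcons⟩
    have hsucc : ∃ c Δ, (canonicalModel (A5 Φ t)).Rel c i Γ Δ ∧ d ∈ Δ.1 := by
      by_contra! hn
      have hbox : ∀ c, (canonicalModel (A5 Φ t)).Holds Γ (box c i (.neg d)) := fun c => by
        rw [Model.box]
        exact fun Δ hΔ => Δ.2.neg.2 (hn c Δ hΔ)
      exact Γ.2.neg.1 (Γ.2.mp (Γ.2.thm (.ax5 hax)) (hbox true)) (hbox false)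
    obtain ⟨c, Δ, hΔ, hdΔ⟩ := hsucc
    have hagree := agreeOn_cells.1 (Model.agreeOn_of_stateDesc (M := pointModel Φ)
      (N := canonicalModel (A5 Φ t)) (x := v) (y := Δ) hd hvd hdΔ)
    refine ⟨c, Δ, hΔ, hagree.1, ?_⟩
    have := realizes_of_agreeOn hagree.2
    simp only [v, Point.mk'_str_other] at this
    exact this

/-- Completeness for the language of index `t`, provided that the systems of smaller index are
sound. -/
theorem exists_holds_of_consistent [Infinite Φ] {t : ℕ}
    (hsound : ∀ s < t, ∀ φ, Derives (A5 Φ s) φ → EventuallyValid φ) {φ : Form Φ}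
    (hφ : φ ∈ Lang Φ t) (hcons : Consistent (Derives (A5 Φ t)) φ) :
    ∃ m : ℕ, ∀ k : Agent → ℕ, (∀ i, m ≤ k i) →
      ∃ x : Point Φ, (∀ i, (x.str i).1 = k i) ∧ x.Holds φ := by
  classical
  obtain ⟨q, hq⟩ := Infinite.exists_notMem_finset φ.atoms.toFinset
  rw [List.mem_toFinset] at hq
  obtain ⟨Γ, -, hΓφ, hΓ⟩ := exists_isMaxConsistent (A := A5 Φ t) (Γ := ∅) (φ := .neg φ)
    fun h => hcons h.of_empty
  have hφΓ : φ ∈ Γ := by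
    by_contra hn
    exact hΓ.neg.1 hΓφ (hΓ.neg.2 hn)
  refine ⟨max (φ.need .a) (φ.need .b), fun k hk => ?_⟩
  choose e he using fun i => exists_realizes_of_isMaxConsistent hsound hq i ⟨Γ, hΓ⟩ le_rfl (hk i)
  let x : Point Φ := ⟨fun i => ⟨k i, e i⟩, {p | .atom p ∈ Γ}⟩
  refine ⟨x, fun _ => rfl, ?_⟩
  exact (Model.holds_iff_of_agreeOn (M := pointModel Φ) (N := canonicalModel (A5 Φ t))
    (x := x) (y := ⟨Γ, hΓ⟩) (fun p hp => hp) (nest_of_mem_lang hφ)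
    (m := fun _ => max (φ.need .a) (φ.need .b)) (fun j => by cases j <;> simp)
    (fun p _ => Iff.rfl) fun j => he j x rfl).2 hφΓ

/-- Eventual validity of the axioms A5: a pair at which `¬ α` is true lies in the structure
of `i` or in its complement. -/
theorem eventuallyValid_of_mem_A5 [Infinite Φ] {t : ℕ}
    (hsound : ∀ s < t, ∀ φ, Derives (A5 Φ s) φ → EventuallyValid φ) {γ : Form Φ}
    (hγ : γ ∈ A5 Φ t) : EventuallyValid γ := by
  obtain ⟨s, hs, i, α, rfl, hlang, hobj, hcons⟩ := mem_A5_iff.1 hγ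
  obtain ⟨m, hm⟩ := exists_holds_of_consistent (fun r hr => hsound r (hr.trans hs)) hlang hcons
  refine ⟨m + 1, fun x hx => ?_⟩
  obtain ⟨k, hk⟩ : ∃ k, (x.str i).1 = k + 1 := ⟨(x.str i).1 - 1, by have := hx i; omega⟩
  obtain ⟨y, hy, hyα⟩ := hm (fun _ => k) fun _ => by have := hx i; omega
  obtain ⟨c, hc⟩ := Point.exists_rel (w := y.world) (B := y.str i.other) (hk.trans (by rw [hy]))
  have hv : (Point.mk' i (x.str i) (y.str i.other) y.world).Holds (.neg α) :=
    (Point.holds_iff_of_objective (x := y) (y := Point.mk' i _ _ _) (by simp) rfl hobj).1 hyα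
  have hbox : ¬ x.Holds (box c i α) := fun h => hv ((x.holds_box c i α).1 h _ hc)
  cases c
  · exact Or.inr hbox
  · exact Or.inl hbox

theorem EventuallyValid.box {φ : Form Φ} (h : EventuallyValid φ) (c : Bool) (i : Agent) :
    EventuallyValid (box c i φ) := by
  obtain ⟨K, hK⟩ := h
  refine ⟨K + 1, fun x hx => (x.holds_box c i φ).2 fun y hy => hK y fun j => ?_⟩
  rcases i.eq_or_eq_other j with rfl | rfl
  · rw [hy.1]
    exact (Nat.le_succ K).trans (hx _)
  · have := hy.level
    have := hx i
    omega

/-- All systems are sound with respect to the structures of sufficiently large levels. -/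
theorem eventuallyValid_of_derives [Infinite Φ] (t : ℕ) :
    ∀ φ : Form Φ, Derives (A5 Φ t) φ → EventuallyValid φ := by
  induction t using Nat.strong_induction_on with
  | _ t hsound =>
  have hdistr : ∀ c i (α β : Form Φ), EventuallyValid
      (.imp (box c i (.imp α β)) (.imp (box c i α) (box c i β))) := fun c i α β =>
    ⟨0, fun x _ => by
      simp only [imp, Point.holds_or, Point.holds_neg, Point.holds_box]
      grind⟩
  intro φ h
  induction h with
  | ax1 h => exact ⟨0, fun x _ => h x.Holds x.holds_neg x.holds_or⟩
  | ax2 i α β => exact hdistr false i α β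
  | ax3 i α β => exact hdistr true i α β
  | @ax4 i σ hσ =>
    refine ⟨0, fun x _ => ?_⟩
    have hbox : ∀ c, x.Holds σ → x.Holds (.box c i σ) := fun c hx =>
      (x.holds_box c i σ).2 fun y hy => ((pointModel Φ).subj hy hσ).1 hx
    have hL := hbox false
    have hN := hbox true
    simp only [imp, Form.and, Form.box, Point.holds_or, Point.holds_neg] at hL hN ⊢
    tauto
  | ax5 h => exact eventuallyValid_of_mem_A5 hsound h
  | mp _ _ ih ih' =>
    obtain ⟨K, hK⟩ := ih
    obtain ⟨K', hK'⟩ := ih'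
    refine ⟨max K K', fun x hx => ?_⟩
    exact (hK x fun i => (le_max_left _ _).trans (hx i)).resolve_left
      (not_not.2 (hK' x fun i => (le_max_right _ _).trans (hx i)))
  | necL i _ ih => exact ih.box false i
  | necN i _ ih => exact ih.box true i

end OnlyKnowing

theorem mainTheorem2 {Φ : Type*} [Infinite Φ] (t : ℕ) (ht : 1 ≤ t)
    (α : OnlyKnowing.Form Φ) (hα : α ∈ OnlyKnowing.ONL Φ t) (h : OnlyKnowing.AX t α) :
    OnlyKnowing.Valid α :=
  (OnlyKnowing.eventuallyValid_of_derives t α h).valid
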